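/- Let $\mathbb T=\mathbb R/\mathbb Z$ and, for $s>1/2$, let $$R_s(x)=\sum_{n=1}^{\infty}\frac{e^{2\pi i n^2x}}{n^{2s}},\qquad x\in\mathbb T .$$ Fix an integer $A\ge 2$. For an integrable function $f:\mathbb T\to\mathbb C$ with Fourier coefficients $\widehat f_n=\int_{\mathbb T} f(x)\,e^{-2\pi i n x}\,dx$ and for $k\in\{0,1,2,\dots\}$ let $$P_kf(x)=\sum_{n\in\mathbb Z,\ A^k\le |n|<A^{k+1}}\widehat f_n\,e^{2\pi i n x}$$ be its Littlewood–Paley blocks with parameter $A$. For $\sigma\in\mathbb R$ and $0<p<\infty$ write $f\in B^{\sigma}_{p,\infty}$ if $$\sup_{k\ge 0}A^{k\sigma}\,\|P_kf\|_{L^p(\mathbb T)}<\infty,\qquad \|g\|_{L^p(\mathbb T)}=\Big(\int_{\mathbb T}|g(x)|^p\,dx\Big)^{1/p}.$$ Let $s>1/2$, $0<p<\infty$, and $$\eta_s(p)=\sup\{\sigma\in\mathbb R \;:\; R_s\in B^{\sigma/p}_{p,\infty}\}$$ (a supremum in $[-\infty,\infty]$). Then, for every choice of the integer $A\ge2$,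 $$\eta_s(p)=\begin{cases}p\,(s-\tfrac14), & p\le 4,\\[2pt] 1+p\,(s-\tfrac12), & p>4.\end{cases}$$ -/

import Mathlib

open scoped ENNReal

noncomputable section

namespace RiemannBesov

/-- The function `R_s(x) = ∑_{n ≥ 1} e^{2πi n² x} / n^{2s}` on the torus `ℝ / ℤ`
(the summation index is shifted by one). Recall that `fourier m x = e^{2πi m x}`. -/
def R (s : ℝ) (x : UnitAddCircle) : ℂ :=
  ∑' n : ℕ, fourier (((n : ℤ) + 1) ^ 2) x / ((((n : ℝ) + 1) ^ (2 * s) : ℝ) : ℂ)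

/-- The integers `n` with `A ^ k ≤ |n| < A ^ (k + 1)`. -/
def annulus (A k : ℕ) : Finset ℤ :=
  (Finset.Ioo (-((A : ℤ) ^ (k + 1))) ((A : ℤ) ^ (k + 1))).filter fun n => (A : ℤ) ^ k ≤ |n|

/-- The Littlewood-Paley projection `P_k f` of `f` onto the frequencies
`A ^ k ≤ |n| < A ^ (k + 1)`. -/
def block (A : ℕ) (f : UnitAddCircle → ℂ) (k : ℕ) (x : UnitAddCircle) : ℂ :=
  ∑ n ∈ annulus A k, fourierCoeff f n * fourier n x

/-- The integrable function `f` on `ℝ / ℤ` belongs to the Besov space `B^σ_{p,∞}`, described with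
the Littlewood-Paley annuli parameter `A`: `sup_k A^{kσ} ‖P_k f‖_{L^p} < ∞`. Here `0 < p < ∞`. The
frequency zero contributes a single constant, which is finite, so that it need not be mentioned. -/
def MemBesov (A : ℕ) (σ p : ℝ) (f : UnitAddCircle → ℂ) : Prop :=
  MeasureTheory.Integrable f AddCircle.haarAddCircle ∧
    ⨆ k : ℕ, ENNReal.ofReal ((A : ℝ) ^ ((k : ℝ) * σ)) *
      MeasureTheory.eLpNorm (block A f k) (ENNReal.ofReal p) AddCircle.haarAddCircle < ∞

/-- The exponent `η_s(p) = sup {σ ∈ ℝ | R_s ∈ B^{σ/p}_{p,∞}}`, as an extended real number. -/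
def eta (A : ℕ) (s p : ℝ) : EReal :=
  sSup {e : EReal | ∃ σ : ℝ, MemBesov A (σ / p) p (R s) ∧ e = (σ : EReal)}

end RiemannBesov

end

/-! ### Fourier coefficients of `R s` and reduction to moments of its blocks. -/

namespace RiemannBesov

open MeasureTheory Filter Topology

/-! Write `X = A ^ k`. The block `P_k R_s` is a trigonometric polynomial with about `X ^ (1/2)`
frequencies `m²`, all its coefficients being comparable to `X ^ (-s)`. Membership in the Besov space
says that `X ^ σ` times the `p`-th moment is bounded in `k` (`memBesov_R_iff`), so everything
reduces to showing that this moment is `X ^ (momentExponent s p)` up to factors `X ^ (±ε)`, which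
the supremum over `σ` does not see.

Orthogonality gives a second moment of order `X ^ (1/2 - 2s)`. The fourth moment counts solutions of
`a² + b² = c² + d²`; there are `O(M ^ (2 + 2ε))` of them up to `M ≈ X ^ (1/2)`
(`exists_card_energySet_le`), whence the bound `X ^ (1 - 4s + ε)`. Thus the second and fourth
moments both point to the typical size `X ^ (1/4 - s)`, and interpolation gives all moments with `p
≤ 4`, from above and below. Interpolation is done by cutting the values of the block at a level near
`X ^ (1/4 - s)`.

For `p > 4` the peak at `0` dominates: on an arc of length about `1 / X` there is no cancellation
and the block has its maximal size `X ^ (1/2 - s)`. This gives the lower bound; the upper bound is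
the supremum to the power `p - 4` times the fourth moment. The two directions are `exists_moment_le`
and `exists_le_moment`. -/

/-- The coefficient `m ^ (-2s)`. -/
noncomputable def weight (s : ℝ) (m : ℕ) : ℝ := ((m : ℝ) ^ (2 * s))⁻¹

lemma weight_nonneg (s : ℝ) (m : ℕ) : 0 ≤ weight s m := by
  unfold weight; positivity

/-- The positive integers whose squares lie in the `k`-th annulus. -/
def roots (A k : ℕ) : Finset ℕ :=
  (Finset.Icc 1 (Nat.sqrt (A ^ (k + 1)))).filter fun m => A ^ k ≤ m ^ 2 ∧ m ^ 2 < A ^ (k + 1)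

lemma norm_fourier_apply (n : ℤ) (x : UnitAddCircle) : ‖fourier n x‖ = 1 := by
  rw [fourier_apply, Circle.norm_coe]

lemma summable_weight_succ {s : ℝ} (hs : 1 / 2 < s) : Summable fun n : ℕ => weight s (n + 1) := by
  have h : Summable fun n : ℕ => ((n : ℝ) ^ (2 * s))⁻¹ :=
    Real.summable_nat_rpow_inv.2 (by linarith)
  exact (summable_nat_add_iff 1).2 h

/-- The terms of the series `R s`, as continuous functions. -/
noncomputable def rTerm (s : ℝ) (n : ℕ) : C(UnitAddCircle, ℂ) :=
  (weight s (n + 1) : ℂ) • fourier (((n : ℤ) + 1) ^ 2)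

lemma rTerm_apply (s : ℝ) (n : ℕ) (x : UnitAddCircle) :
    rTerm s n x = (weight s (n + 1) : ℂ) * fourier (((n : ℤ) + 1) ^ 2) x := rfl

lemma norm_rTerm_apply (s : ℝ) (n : ℕ) (x : UnitAddCircle) :
    ‖rTerm s n x‖ = weight s (n + 1) := by
  rw [rTerm_apply, norm_mul, norm_fourier_apply, mul_one, Complex.norm_real,
    Real.norm_of_nonneg (weight_nonneg _ _)]

lemma R_eq_tsum (s : ℝ) (x : UnitAddCircle) : R s x = ∑' n, rTerm s n x := by
  unfold R
  refine tsum_congr fun n => ?_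
  rw [rTerm_apply, weight, div_eq_mul_inv, mul_comm]
  push_cast
  rfl

lemma continuous_R {s : ℝ} (hs : 1 / 2 < s) : Continuous (R s) := by
  have h : R s = fun x => ∑' n, rTerm s n x := funext (R_eq_tsum s)
  rw [h]
  exact continuous_tsum (fun n => (rTerm s n).continuous) (summable_weight_succ hs)
    fun n x => (norm_rTerm_apply s n x).le

lemma integrable_R {s : ℝ} (hs : 1 / 2 < s) : Integrable (R s) AddCircle.haarAddCircle :=
  (continuous_R hs).integrable_of_hasCompactSupport (HasCompactSupport.of_compactSpace _)

lemma fourierCoeff_rTerm (s : ℝ) (j : ℕ) (n : ℤ) :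
    fourierCoeff (rTerm s j) n = if n = ((j : ℤ) + 1) ^ 2 then (weight s (j + 1) : ℂ) else 0 := by
  have h : (rTerm s j : UnitAddCircle → ℂ) =
      fun x => (weight s (j + 1) : ℂ) • fourier (((j : ℤ) + 1) ^ 2) x := rfl
  rw [h]
  have := fourierCoeff.const_smul (T := 1) (fourier (((j : ℤ) + 1) ^ 2) : UnitAddCircle → ℂ)
    (weight s (j + 1) : ℂ) n
  refine this.trans ?_
  rw [fourierCoeff_fourier, Pi.single_apply]
  split_ifs <;> simp

/-- The series converges absolutely and uniformly because `2s > 1`, so it may be integrated term by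
term. -/
lemma hasSum_fourierCoeff_R {s : ℝ} (hs : 1 / 2 < s) (n : ℤ) :
    HasSum (fun j => fourierCoeff (rTerm s j) n) (fourierCoeff (R s) n) := by
  have hcont (j : ℕ) : Continuous fun t => fourier (-n) t • rTerm s j t :=
    (map_continuous (fourier (-n))).smul (rTerm s j).continuous
  have hnorm (j : ℕ) (t : UnitAddCircle) :
      ‖fourier (-n) t • rTerm s j t‖ = weight s (j + 1) := by
    rw [norm_smul, norm_fourier_apply, one_mul, norm_rTerm_apply]
  have h := hasSum_integral_of_summable_integral_norm
    (μ := AddCircle.haarAddCircle (T := (1 : ℝ)))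
    (F := fun j t => fourier (-n) t • rTerm s j t)
    (fun j => (hcont j).integrable_of_hasCompactSupport (HasCompactSupport.of_compactSpace _))
    (by simpa only [hnorm, integral_const, probReal_univ, one_smul]
          using! summable_weight_succ hs)
  have he : fourierCoeff (R s) n =
      ∫ t, ∑' j, fourier (-n) t • rTerm s j t ∂(AddCircle.haarAddCircle (T := (1 : ℝ))) := by
    unfold fourierCoeff
    congr 1
    funext t
    rw [R_eq_tsum, tsum_const_smul'']
  rw [he]
  exact h

lemma fourierCoeff_R_sq {s : ℝ} (hs : 1 / 2 < s) {m : ℕ} (hm : 1 ≤ m) :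
    fourierCoeff (R s) ((m : ℤ) ^ 2) = weight s m := by
  obtain ⟨j, rfl⟩ : ∃ j, m = j + 1 := ⟨m - 1, by omega⟩
  refine (hasSum_fourierCoeff_R hs _).unique ?_
  convert hasSum_single j ?_ using 1
  · rw [fourierCoeff_rTerm, if_pos (by push_cast; rfl)]
  · intro i hi
    rw [fourierCoeff_rTerm, if_neg]
    intro h
    have h1 := (sq_eq_sq₀ (by positivity) (by positivity)).1 h
    push_cast at h1
    omega

lemma fourierCoeff_R_of_not_sq {s : ℝ} (hs : 1 / 2 < s) {n : ℤ}
    (hn : ∀ m : ℕ, 1 ≤ m → n ≠ (m : ℤ) ^ 2) : fourierCoeff (R s) n = 0 := by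
  refine (hasSum_fourierCoeff_R hs _).unique ?_
  convert hasSum_zero with j
  rw [fourierCoeff_rTerm, if_neg]
  have := hn (j + 1) (by omega)
  push_cast at this
  exact this

/-- The trigonometric polynomial with frequencies the squares in the `k`-th annulus. -/
noncomputable def squarePoly (A : ℕ) (s : ℝ) (k : ℕ) (x : UnitAddCircle) : ℂ :=
  ∑ m ∈ roots A k, (weight s m : ℂ) * fourier ((m : ℤ) ^ 2) x

lemma mem_roots {A k m : ℕ} : m ∈ roots A k ↔ 1 ≤ m ∧ A ^ k ≤ m ^ 2 ∧ m ^ 2 < A ^ (k + 1) := by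
  simp only [roots, Finset.mem_filter, Finset.mem_Icc]
  constructor
  · rintro ⟨⟨h1, -⟩, h⟩
    exact ⟨h1, h⟩
  · rintro ⟨h1, h⟩
    exact ⟨⟨h1, Nat.le_sqrt'.2 h.2.le⟩, h⟩

lemma block_R {A k : ℕ} {s : ℝ} (hs : 1 / 2 < s) : block A (R s) k = squarePoly A s k := by
  funext x
  unfold block squarePoly
  have hinj : Set.InjOn (fun m : ℕ => (m : ℤ) ^ 2) (roots A k) := by
    intro a _ b _ h
    have := (sq_eq_sq₀ (by positivity) (by positivity)).1 h
    exact_mod_cast this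
  have h1 : ∑ m ∈ roots A k, (weight s m : ℂ) * fourier ((m : ℤ) ^ 2) x =
      ∑ n ∈ (roots A k).image (fun m : ℕ => (m : ℤ) ^ 2), fourierCoeff (R s) n * fourier n x := by
    rw [Finset.sum_image hinj]
    refine Finset.sum_congr rfl fun m hm => ?_
    rw [fourierCoeff_R_sq hs (mem_roots.1 hm).1]
  rw [h1]
  symm
  refine Finset.sum_subset ?_ ?_
  · intro n hn
    obtain ⟨m, hm, rfl⟩ := Finset.mem_image.1 hn
    obtain ⟨-, h2, h3⟩ := mem_roots.1 hm
    zify at h2 h3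
    have h4 : (0 : ℤ) ≤ (m : ℤ) ^ 2 := by positivity
    simp only [annulus, Finset.mem_filter, Finset.mem_Ioo, abs_of_nonneg h4]
    exact ⟨⟨by linarith, h3⟩, h2⟩
  · intro n hn hn'
    rw [fourierCoeff_R_of_not_sq hs, zero_mul]
    rintro m hm rfl
    have h4 : (0 : ℤ) ≤ (m : ℤ) ^ 2 := by positivity
    simp only [annulus, Finset.mem_filter, Finset.mem_Ioo, abs_of_nonneg h4] at hn
    refine hn' (Finset.mem_image_of_mem _ (mem_roots.2 ⟨hm, ?_, ?_⟩))
    · exact_mod_cast hn.2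
    · exact_mod_cast hn.1.2

lemma continuous_squarePoly (A : ℕ) (s : ℝ) (k : ℕ) : Continuous (squarePoly A s k) := by
  unfold squarePoly
  exact continuous_finsetSum _ fun m _ => continuous_const.mul (map_continuous _)

/-- The integral of `‖P_k R_s‖ ^ p` over the torus. -/
noncomputable def moment (A : ℕ) (s : ℝ) (k : ℕ) (p : ℝ) : ℝ :=
  ∫ x, ‖squarePoly A s k x‖ ^ p ∂(AddCircle.haarAddCircle (T := (1 : ℝ)))

lemma integrable_norm_squarePoly_rpow (A : ℕ) (s : ℝ) (k : ℕ) {p : ℝ} (hp : 0 ≤ p) :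
    Integrable (fun x => ‖squarePoly A s k x‖ ^ p) (AddCircle.haarAddCircle (T := (1 : ℝ))) :=
  ((continuous_squarePoly A s k).norm.rpow_const fun _ => Or.inr hp)
    |>.integrable_of_hasCompactSupport (HasCompactSupport.of_compactSpace _)

lemma moment_nonneg (A : ℕ) (s : ℝ) (k : ℕ) (p : ℝ) : 0 ≤ moment A s k p :=
  integral_nonneg fun _ => by positivity

/-- Each term of the Besov supremum is the `p`-th root of `X ^ σ` times the moment; taking `p`-th
powers removes the root. -/
lemma memBesov_R_iff {A : ℕ} (hA : 2 ≤ A) {s σ p : ℝ} (hs : 1 / 2 < s) (hp : 0 < p) :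
    MemBesov A (σ / p) p (R s) ↔
      ∃ C : ℝ, ∀ k : ℕ, ((A : ℝ) ^ k) ^ σ * moment A s k p ≤ C := by
  have hA0 : (0 : ℝ) < A := by positivity
  have key (k : ℕ) : ENNReal.ofReal ((A : ℝ) ^ ((k : ℝ) * (σ / p))) *
      eLpNorm (block A (R s) k) (ENNReal.ofReal p) AddCircle.haarAddCircle =
      ENNReal.ofReal ((((A : ℝ) ^ k) ^ σ * moment A s k p) ^ p⁻¹) := by
    have hmem : MemLp (squarePoly A s k) (ENNReal.ofReal p)
        (AddCircle.haarAddCircle (T := (1 : ℝ))) :=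
      (continuous_squarePoly A s k).memLp_of_hasCompactSupport
        (HasCompactSupport.of_compactSpace _)
    rw [block_R hs, hmem.eLpNorm_eq_integral_rpow_norm (by simpa using hp) ENNReal.ofReal_ne_top,
      ENNReal.toReal_ofReal hp.le, ← ENNReal.ofReal_mul (by positivity),
      Real.mul_rpow (by positivity) (moment_nonneg _ _ _ _), moment, ← Real.rpow_mul (by positivity),
      ← Real.rpow_natCast, ← Real.rpow_mul hA0.le, div_eq_mul_inv]
  unfold MemBesov
  simp only [key, integrable_R hs, true_and]
  have hnn (k : ℕ) : 0 ≤ ((A : ℝ) ^ k) ^ σ * moment A s k p :=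
    mul_nonneg (by positivity) (moment_nonneg _ _ _ _)
  constructor
  · intro h
    refine ⟨(⨆ k : ℕ, ENNReal.ofReal ((((A : ℝ) ^ k) ^ σ * moment A s k p) ^ p⁻¹)).toReal ^ p,
      fun k => ?_⟩
    have h1 := (ENNReal.ofReal_le_iff_le_toReal h.ne).1
      (le_iSup (fun k : ℕ => ENNReal.ofReal ((((A : ℝ) ^ k) ^ σ * moment A s k p) ^ p⁻¹)) k)
    exact (Real.rpow_inv_le_iff_of_pos (hnn k) ENNReal.toReal_nonneg hp).1 h1
  · rintro ⟨C, hC⟩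
    refine lt_of_le_of_lt (iSup_le fun k => ENNReal.ofReal_le_ofReal
      (Real.rpow_le_rpow (hnn k) (hC k) (by positivity))) ENNReal.ofReal_lt_top

/-- Expansion of the mean square of a trigonometric polynomial with repeated frequencies. -/
lemma integral_sq_norm_sum_fourier {ι : Type*} (S : Finset ι) (a : ι → ℝ) (φ : ι → ℤ) :
    ∫ x, ‖∑ i ∈ S, (a i : ℂ) * fourier (φ i) x‖ ^ 2 ∂(AddCircle.haarAddCircle (T := (1 : ℝ))) =
      ∑ i ∈ S, ∑ j ∈ S, if φ i = φ j then a i * a j else 0 := by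
  have hint (n : ℤ) (c : ℂ) : Integrable (fun x => c * fourier n x)
      (AddCircle.haarAddCircle (T := (1 : ℝ))) :=
    (continuous_const.mul (map_continuous (fourier n))).integrable_of_hasCompactSupport
      (HasCompactSupport.of_compactSpace _)
  have hzero (n : ℤ) : ∫ x, fourier n x ∂(AddCircle.haarAddCircle (T := (1 : ℝ))) =
      if n = 0 then 1 else 0 := by
    have h := congrFun (fourierCoeff_fourier (T := (1 : ℝ)) n) 0
    simp only [fourierCoeff, neg_zero, fourier_zero, one_smul, Pi.single_apply] at h
    rw [h]
    simp only [eq_comm]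
  have hexp (x : UnitAddCircle) : (((‖∑ i ∈ S, (a i : ℂ) * fourier (φ i) x‖ ^ 2 : ℝ)) : ℂ) =
      ∑ i ∈ S, ∑ j ∈ S, ((a i * a j : ℝ) : ℂ) * fourier (φ i - φ j) x := by
    rw [Complex.ofReal_pow, ← Complex.mul_conj', map_sum, Finset.sum_mul_sum]
    refine Finset.sum_congr rfl fun i _ => Finset.sum_congr rfl fun j _ => ?_
    rw [map_mul, ← fourier_neg, sub_eq_add_neg, fourier_add, Complex.conj_ofReal]
    push_cast
    ring
  have h : ((∫ x, ‖∑ i ∈ S, (a i : ℂ) * fourier (φ i) x‖ ^ 2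
      ∂(AddCircle.haarAddCircle (T := (1 : ℝ))) : ℝ) : ℂ) =
      ((∑ i ∈ S, ∑ j ∈ S, if φ i = φ j then a i * a j else 0 : ℝ) : ℂ) := by
    rw [← integral_complex_ofReal]
    simp only [hexp]
    rw [integral_finsetSum _ fun i _ => integrable_finsetSum _ fun j _ => hint _ _]
    push_cast
    refine Finset.sum_congr rfl fun i _ => ?_
    rw [integral_finsetSum _ fun j _ => hint _ _]
    refine Finset.sum_congr rfl fun j _ => ?_
    rw [integral_const_mul, hzero]
    simp only [sub_eq_zero]
    split_ifs <;> simp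
  exact_mod_cast h

end RiemannBesov

/-! ### Additive energy of the squares. -/

namespace RiemannBesov

open Finset

/-- The solutions of `a² + b² = c² + d²` with `1 ≤ a, b, c, d ≤ M`, as quadruples
`((a, b), (c, d))`. -/
def energySet (M : ℕ) : Finset ((ℕ × ℕ) × (ℕ × ℕ)) :=
  ((Icc 1 M ×ˢ Icc 1 M) ×ˢ (Icc 1 M ×ˢ Icc 1 M)).filter fun q =>
    q.1.1 ^ 2 + q.1.2 ^ 2 = q.2.1 ^ 2 + q.2.2 ^ 2

lemma mem_energySet {M a b c d : ℕ} : ((a, b), (c, d)) ∈ energySet M ↔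
    ((1 ≤ a ∧ a ≤ M) ∧ (1 ≤ b ∧ b ≤ M)) ∧ ((1 ≤ c ∧ c ≤ M) ∧ (1 ≤ d ∧ d ≤ M)) ∧
      a ^ 2 + b ^ 2 = c ^ 2 + d ^ 2 := by
  simp only [energySet, mem_filter, mem_product, mem_Icc, and_assoc]

/-- Parameters `(u, w, g, t)` with `g u ≤ N` and `t w ≤ N`. -/
def paramSet (N : ℕ) : Finset ((_ : ℕ × ℕ) × (ℕ × ℕ)) :=
  (Icc 1 N ×ˢ Icc 1 N).sigma fun q => Icc 1 (N / q.1) ×ˢ Icc 1 (N / q.2)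

lemma card_paramSet (N : ℕ) : #(paramSet N) = (∑ u ∈ Icc 1 N, N / u) ^ 2 := by
  simp only [paramSet, card_sigma, card_product, Nat.card_Icc, Nat.add_sub_cancel]
  rw [sum_product, sq, sum_mul_sum]

/-- Take `g = gcd u w`; after division by `g` the cofactor `w'` is coprime to `u'`, hence divides
`v`, and `t` is the quotient. -/
lemma exists_param {u v w z : ℕ} (hu : 0 < u) (hw : 0 < w) (h : u * v = w * z) :
    ∃ u' w' g t, u = g * u' ∧ w = g * w' ∧ v = w' * t ∧ z = u' * t := by
  obtain ⟨u', w', hcop, hu', hw'⟩ := Nat.exists_coprime u w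
  have hg : 0 < u.gcd w := Nat.gcd_pos_of_pos_left _ hu
  have hw0 : 0 < w' := by
    rcases Nat.eq_zero_or_pos w' with h0 | h0
    · rw [h0, zero_mul] at hw'; omega
    · exact h0
  have h2 : u' * v = w' * z := by
    have : (u.gcd w) * (u' * v) = (u.gcd w) * (w' * z) := by
      calc (u.gcd w) * (u' * v) = (u' * u.gcd w) * v := by ring
        _ = (w' * u.gcd w) * z := by rw [← hu', ← hw', h]
        _ = _ := by ring
    exact Nat.eq_of_mul_eq_mul_left hg this
  obtain ⟨t, ht⟩ : w' ∣ v := hcop.symm.dvd_of_dvd_mul_left ⟨z, h2⟩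
  refine ⟨u', w', u.gcd w, t, by rw [mul_comm]; exact hu', by rw [mul_comm]; exact hw', ht, ?_⟩
  refine Nat.eq_of_mul_eq_mul_left hw0 ?_
  rw [← h2, ht]
  ring

/-- The equation reads `(a - c)(a + c) = (d - b)(d + b)`. Factoring both sides as in `exists_param`
gives `a - c = g u'`, `a + c = w' t`, `d - b = g w'`, `d + b = u' t`, all at most `2M`. The map
below recovers `a, b, c, d` as half sums and half differences, so every solution with `c < a` comes
from some parameter. -/
lemma card_energySet_lt (M : ℕ) :
    #((energySet M).filter fun q => q.2.1 < q.1.1) ≤ #(paramSet (2 * M)) := by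
  refine card_le_card_of_surjOn (fun q : (_ : ℕ × ℕ) × (ℕ × ℕ) =>
    (((q.1.2 * q.2.2 + q.2.1 * q.1.1) / 2, (q.1.1 * q.2.2 - q.2.1 * q.1.2) / 2),
      ((q.1.2 * q.2.2 - q.2.1 * q.1.1) / 2, (q.1.1 * q.2.2 + q.2.1 * q.1.2) / 2))) ?_
  rintro ⟨⟨a, b⟩, ⟨c, d⟩⟩ hq
  rw [mem_coe, mem_filter, mem_energySet] at hq
  obtain ⟨⟨⟨⟨ha, ha'⟩, hb, hb'⟩, ⟨⟨hc, hc'⟩, hd, hd'⟩, h⟩, hac⟩ := hq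
  simp only at hac
  have hbd : b < d := by nlinarith
  -- Here `a - c = u + 1` and `d - b = w + 1`, which makes both differences visibly positive.
  obtain ⟨u, rfl⟩ := Nat.exists_eq_add_of_lt hac
  obtain ⟨w, rfl⟩ := Nat.exists_eq_add_of_lt hbd
  have hprod : (u + 1) * (c + u + 1 + c) = (w + 1) * (b + w + 1 + b) := by nlinarith
  obtain ⟨u', w', g, t, h1, h2, h3, h4⟩ := exists_param (Nat.succ_pos u) (Nat.succ_pos w) hprod
  have hg : 0 < g := Nat.pos_of_ne_zero (by rintro rfl; omega)
  have hu' : 0 < u' := Nat.pos_of_ne_zero (by rintro rfl; omega)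
  have hw' : 0 < w' := Nat.pos_of_ne_zero (by rintro rfl; omega)
  have ht : 0 < t := Nat.pos_of_ne_zero (by rintro rfl; omega)
  refine ⟨⟨(u', w'), (g, t)⟩, ?_, ?_⟩
  · have e1 : u' ≤ g * u' := Nat.le_mul_of_pos_left _ hg
    have e2 : w' ≤ g * w' := Nat.le_mul_of_pos_left _ hg
    simp only [paramSet, mem_coe, mem_sigma, mem_product, mem_Icc, Nat.le_div_iff_mul_le hu',
      Nat.le_div_iff_mul_le hw', mul_comm t w', ← h1, ← h3]
    omega
  · simp only [← h1, ← h2, ← h3, ← h4, Prod.mk.injEq]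
    omega

/-- If `a = c` then `b = d`, so these solutions are determined by `(a, b)`; those with `a < c`
inject into those with `c < a` by exchanging the two pairs. -/
lemma card_energySet_le (M : ℕ) :
    #(energySet M) ≤ M ^ 2 + 2 * (∑ u ∈ Icc 1 (2 * M), (2 * M) / u) ^ 2 := by
  rw [← card_paramSet]
  have hlt := card_energySet_lt M
  have hgt : #((energySet M).filter fun q => q.1.1 < q.2.1) ≤
      #((energySet M).filter fun q => q.2.1 < q.1.1) := by
    refine card_le_card_of_injOn Prod.swap ?_ Prod.swap_injective.injOn
    rintro ⟨⟨a, b⟩, ⟨c, d⟩⟩ hq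
    rw [mem_coe, mem_filter, mem_energySet] at hq
    rw [Prod.swap_prod_mk, mem_coe, mem_filter, mem_energySet]
    exact ⟨⟨hq.1.2.1, hq.1.1, hq.1.2.2.symm⟩, hq.2⟩
  have heq : #((energySet M).filter fun q => q.1.1 = q.2.1) ≤ M ^ 2 := by
    have : #(Icc 1 M ×ˢ Icc 1 M) = M ^ 2 := by simp [sq]
    rw [← this]
    refine card_le_card_of_injOn (fun q => q.1) ?_ ?_
    · rintro ⟨⟨a, b⟩, ⟨c, d⟩⟩ hq
      rw [mem_coe, mem_filter, mem_energySet] at hq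
      simp only [coe_product, Set.mem_prod, mem_coe, mem_Icc]
      exact hq.1.1
    · rintro ⟨⟨a, b⟩, ⟨c, d⟩⟩ hq ⟨⟨a', b'⟩, ⟨c', d'⟩⟩ hq' h
      rw [mem_coe, mem_filter, mem_energySet] at hq hq'
      simp only [Prod.mk.injEq] at h hq hq' ⊢
      obtain ⟨rfl, rfl⟩ := h
      obtain ⟨⟨-, -, h1⟩, rfl⟩ := hq
      obtain ⟨⟨-, -, h2⟩, rfl⟩ := hq'
      have h3 : d ^ 2 = d' ^ 2 := by omega
      exact ⟨⟨rfl, rfl⟩, rfl, Nat.pow_left_injective (n := 2) (by norm_num) h3⟩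
  have hcover : energySet M ⊆ (energySet M).filter (fun q => q.1.1 = q.2.1) ∪
      ((energySet M).filter (fun q => q.2.1 < q.1.1) ∪
        (energySet M).filter (fun q => q.1.1 < q.2.1)) := by
    intro q hq
    simp only [mem_union, mem_filter, hq, true_and]
    omega
  have h1 := card_le_card hcover
  have h2 := card_union_le ((energySet M).filter (fun q => q.1.1 = q.2.1))
    ((energySet M).filter (fun q => q.2.1 < q.1.1) ∪
        (energySet M).filter (fun q => q.1.1 < q.2.1))
  have h3 := card_union_le ((energySet M).filter (fun q => q.2.1 < q.1.1))
        ((energySet M).filter (fun q => q.1.1 < q.2.1))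
  omega

lemma sum_div_le (N : ℕ) :
    ((∑ u ∈ Icc 1 N, N / u : ℕ) : ℝ) ≤ N * (1 + Real.log N) := by
  have h : ((harmonic N : ℚ) : ℝ) = ∑ u ∈ Icc 1 N, ((u : ℝ))⁻¹ := by
    rw [harmonic_eq_sum_Icc]; push_cast; rfl
  calc ((∑ u ∈ Icc 1 N, N / u : ℕ) : ℝ) ≤ ∑ u ∈ Icc 1 N, (N : ℝ) * (u : ℝ)⁻¹ := by
        push_cast
        refine sum_le_sum fun u _ => ?_
        rw [← div_eq_mul_inv]
        exact Nat.cast_div_le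
    _ = N * ((harmonic N : ℚ) : ℝ) := by rw [h, mul_sum]
    _ ≤ _ := by gcongr; exact harmonic_le_one_add_log N

/-- The additive energy of the squares up to `M` is `O(M^(2 + ε))`. -/
lemma exists_card_energySet_le {ε : ℝ} (hε : 0 < ε) :
    ∃ C : ℝ, 0 < C ∧ ∀ M : ℕ, 1 ≤ M → (#(energySet M) : ℝ) ≤ C * (M : ℝ) ^ (2 + 2 * ε) := by
  -- The divisor sum is at most `2M (1 + log (2M))`, and `log (2M) ≤ (2M) ^ ε / ε`; squaring the sum
  -- doubles `ε`.
  refine ⟨1 + 2 * (2 * (1 + 2 ^ ε / ε)) ^ 2, by positivity, fun M hM => ?_⟩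
  have hM1 : (1 : ℝ) ≤ M := by exact_mod_cast hM
  have hM0 : (0 : ℝ) < M := by linarith
  have h1 : (#(energySet M) : ℝ) ≤
      (M : ℝ) ^ 2 + 2 * ((∑ u ∈ Icc 1 (2 * M), (2 * M) / u : ℕ) : ℝ) ^ 2 := by
    exact_mod_cast card_energySet_le M
  have h2 := sum_div_le (2 * M)
  have hpow : (1 : ℝ) ≤ (M : ℝ) ^ ε := Real.one_le_rpow hM1 hε.le
  have hlog : Real.log ((2 * M : ℕ) : ℝ) ≤ 2 ^ ε / ε * (M : ℝ) ^ ε := by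
    have := Real.log_le_rpow_div (x := ((2 * M : ℕ) : ℝ)) (by positivity) hε
    refine this.trans_eq ?_
    push_cast
    rw [Real.mul_rpow (by norm_num) hM0.le]
    ring
  have h3 : ((∑ u ∈ Icc 1 (2 * M), (2 * M) / u : ℕ) : ℝ) ≤
      (2 * (1 + 2 ^ ε / ε)) * ((M : ℝ) * (M : ℝ) ^ ε) := by
    refine h2.trans ?_
    have : 1 + Real.log ((2 * M : ℕ) : ℝ) ≤ (1 + 2 ^ ε / ε) * (M : ℝ) ^ ε := by linarith
    calc ((2 * M : ℕ) : ℝ) * (1 + Real.log ((2 * M : ℕ) : ℝ))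
        ≤ ((2 * M : ℕ) : ℝ) * ((1 + 2 ^ ε / ε) * (M : ℝ) ^ ε) := by gcongr
      _ = _ := by push_cast; ring
  have hsq : (M : ℝ) ^ (2 + 2 * ε) = ((M : ℝ) * (M : ℝ) ^ ε) ^ 2 := by
    rw [mul_pow, ← Real.rpow_natCast ((M : ℝ) ^ ε), ← Real.rpow_mul hM0.le,
      ← Real.rpow_natCast (M : ℝ), ← Real.rpow_add hM0]
    push_cast
    ring_nf
  rw [hsq]
  have h4 : (M : ℝ) ^ 2 ≤ ((M : ℝ) * (M : ℝ) ^ ε) ^ 2 := by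
    gcongr
    exact le_mul_of_one_le_right hM0.le hpow
  have h5 : ((∑ u ∈ Icc 1 (2 * M), (2 * M) / u : ℕ) : ℝ) ^ 2 ≤
      ((2 * (1 + 2 ^ ε / ε)) * ((M : ℝ) * (M : ℝ) ^ ε)) ^ 2 := by
    gcongr
  rw [mul_pow] at h5
  linarith

end RiemannBesov

/-! ### Size of the blocks, second and fourth moments. -/

namespace RiemannBesov

open MeasureTheory Filter Topology

lemma one_le_scale {A : ℕ} (hA : 2 ≤ A) (k : ℕ) : (1 : ℝ) ≤ (A : ℝ) ^ k :=
  one_le_pow₀ (by exact_mod_cast (by omega : 1 ≤ A))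

lemma tendsto_scale {A : ℕ} (hA : 2 ≤ A) : Tendsto (fun k : ℕ => (A : ℝ) ^ k) atTop atTop :=
  tendsto_pow_atTop_atTop_of_one_lt (by exact_mod_cast (by omega : 1 < A))

lemma weight_eq (s : ℝ) (m : ℕ) : weight s m = ((m : ℝ) ^ 2) ^ (-s) := by
  rw [weight, Real.rpow_neg (by positivity), ← Real.rpow_natCast (m : ℝ),
    ← Real.rpow_mul (by positivity)]
  norm_num

lemma weight_le {A k m : ℕ} {s : ℝ} (hA : 2 ≤ A) (hs : 0 ≤ s) (hm : m ∈ roots A k) :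
    weight s m ≤ ((A : ℝ) ^ k) ^ (-s) := by
  rw [weight_eq]
  have := one_le_scale hA k
  exact Real.rpow_le_rpow_of_nonpos (by linarith) (by exact_mod_cast (mem_roots.1 hm).2.1)
    (by linarith)

lemma le_weight {A k m : ℕ} {s : ℝ} (hs : 0 ≤ s) (hm : m ∈ roots A k) :
    ((A : ℝ) * (A : ℝ) ^ k) ^ (-s) ≤ weight s m := by
  rw [weight_eq, ← pow_succ']
  have h1 : (1 : ℝ) ≤ m := by exact_mod_cast (mem_roots.1 hm).1
  exact Real.rpow_le_rpow_of_nonpos (by positivity)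
    (by exact_mod_cast (mem_roots.1 hm).2.2.le) (by linarith)

lemma sqrt_scale_le (A k : ℕ) :
    (Nat.sqrt (A ^ (k + 1)) : ℝ) ≤ ((A : ℝ) * (A : ℝ) ^ k) ^ (1 / 2 : ℝ) := by
  rw [← Real.sqrt_eq_rpow, ← pow_succ']
  exact_mod_cast Real.nat_sqrt_le_real_sqrt (a := A ^ (k + 1))

lemma card_roots_le (A k : ℕ) :
    ((roots A k).card : ℝ) ≤ ((A : ℝ) * (A : ℝ) ^ k) ^ (1 / 2 : ℝ) := by
  refine le_trans ?_ (sqrt_scale_le A k)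
  have := Finset.card_filter_le (Finset.Icc 1 (Nat.sqrt (A ^ (k + 1))))
    fun m => A ^ k ≤ m ^ 2 ∧ m ^ 2 < A ^ (k + 1)
  rw [Nat.card_Icc, Nat.add_sub_cancel] at this
  exact_mod_cast this

lemma le_card_roots {A k : ℕ} (hA : 2 ≤ A) (hk : 36 ≤ A ^ k) :
    ((A : ℝ) ^ k) ^ (1 / 2 : ℝ) / 6 ≤ (roots A k).card := by
  set a := Nat.sqrt (A ^ k) with ha
  have ha1 : a ^ 2 ≤ A ^ k := Nat.sqrt_le' _
  have ha2 : A ^ k < (a + 1) ^ 2 := Nat.lt_succ_sqrt' _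
  have ha6 : 6 ≤ a := Nat.le_sqrt.2 (by omega)
  -- Going up to `4a/3` is safe since `(4/3)² < 2 ≤ A`; `a ≥ 6` makes `a / 3`, rounded down, at
  -- least `(a + 1) / 6`.
  have hsub : Finset.Icc (a + 1) (a + a / 3) ⊆ roots A k := by
    intro m hm
    rw [Finset.mem_Icc] at hm
    refine mem_roots.2 ⟨by omega, ha2.le.trans (Nat.pow_le_pow_left hm.1 2), ?_⟩
    have h3 : 3 * m ≤ 4 * a := by omega
    have h4 : m ^ 2 < 2 * a ^ 2 := by nlinarith
    calc m ^ 2 < 2 * a ^ 2 := h4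
      _ ≤ A * A ^ k := Nat.mul_le_mul hA ha1
      _ = A ^ (k + 1) := (pow_succ' _ _).symm
  have hcard := Finset.card_le_card hsub
  rw [Nat.card_Icc] at hcard
  have h5 : a + 1 ≤ 6 * (roots A k).card := by omega
  have h6 : Real.sqrt ((A : ℝ) ^ k) ≤ (a : ℝ) + 1 := by
    refine Real.sqrt_le_left (by positivity) |>.2 ?_
    exact_mod_cast ha2.le
  have h7 : (a : ℝ) + 1 ≤ 6 * (roots A k).card := by exact_mod_cast h5
  rw [← Real.sqrt_eq_rpow]
  linarith

lemma eventually_le_card_roots {A : ℕ} (hA : 2 ≤ A) :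
    ∀ᶠ k in atTop, ((A : ℝ) ^ k) ^ (1 / 2 : ℝ) / 6 ≤ (roots A k).card := by
  filter_upwards [(tendsto_scale hA).eventually_ge_atTop 36] with k hk
  exact le_card_roots hA (by exact_mod_cast hk)

lemma moment_two_eq (A : ℕ) (s : ℝ) (k : ℕ) :
    moment A s k 2 = ∑ m ∈ roots A k, weight s m ^ 2 := by
  unfold moment squarePoly
  simp only [Real.rpow_two]
  refine (integral_sq_norm_sum_fourier (roots A k) (weight s) fun m => (m : ℤ) ^ 2).trans ?_
  refine Finset.sum_congr rfl fun m hm => ?_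
  have h (j : ℕ) : (m : ℤ) ^ 2 = (j : ℤ) ^ 2 ↔ m = j := by
    rw [sq_eq_sq₀ (by positivity) (by positivity)]
    norm_cast
  simp only [h, Finset.sum_ite_eq, hm, if_true]
  rw [sq]

lemma le_moment_two {A k : ℕ} {s : ℝ} (hs : 0 ≤ s) :
    (roots A k).card * ((A : ℝ) * (A : ℝ) ^ k) ^ (-(2 * s)) ≤ moment A s k 2 := by
  rw [moment_two_eq, ← nsmul_eq_mul]
  refine Finset.card_nsmul_le_sum _ _ _ fun m hm => ?_
  have h : ((A : ℝ) * (A : ℝ) ^ k) ^ (-(2 * s)) = (((A : ℝ) * (A : ℝ) ^ k) ^ (-s)) ^ 2 := by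
    rw [← Real.rpow_natCast (_ ^ (-s)), ← Real.rpow_mul (by positivity)]
    push_cast
    ring_nf
  rw [h]
  have := le_weight hs hm
  gcongr

lemma exists_le_moment_two {A : ℕ} (hA : 2 ≤ A) {s : ℝ} (hs : 0 ≤ s) :
    ∃ c : ℝ, 0 < c ∧ ∀ᶠ k in atTop, c * ((A : ℝ) ^ k) ^ (1 / 2 - 2 * s) ≤ moment A s k 2 := by
  refine ⟨(A : ℝ) ^ (-(2 * s)) / 6, by positivity, ?_⟩
  filter_upwards [eventually_le_card_roots hA] with k hk
  have hX : (0 : ℝ) < (A : ℝ) ^ k := by positivity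
  refine le_trans ?_ (le_moment_two hs)
  rw [Real.mul_rpow (by positivity) hX.le, sub_eq_add_neg, Real.rpow_add hX]
  calc (A : ℝ) ^ (-(2 * s)) / 6 * (((A : ℝ) ^ k) ^ (1 / 2 : ℝ) * ((A : ℝ) ^ k) ^ (-(2 * s)))
      = ((A : ℝ) ^ k) ^ (1 / 2 : ℝ) / 6 *
        ((A : ℝ) ^ (-(2 * s)) * ((A : ℝ) ^ k) ^ (-(2 * s))) := by ring
    _ ≤ _ := by gcongr

/-- The fourth power of the modulus is the squared modulus of the square of the polynomial, whose
frequencies are the sums `a² + b²`; orthogonality leaves only quadruples in `energySet`. -/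
lemma moment_four_le {A k : ℕ} {s : ℝ} (hA : 2 ≤ A) (hs : 0 ≤ s) :
    moment A s k 4 ≤
      ((A : ℝ) ^ k) ^ (-(4 * s)) * (energySet (Nat.sqrt (A ^ (k + 1)))).card := by
  set S := roots A k with hS
  set w : ℝ := ((A : ℝ) ^ k) ^ (-s) with hw
  have hX : (0 : ℝ) < (A : ℝ) ^ k := by positivity
  have hw4 : ((A : ℝ) ^ k) ^ (-(4 * s)) = (w * w) * (w * w) := by
    rw [hw, ← Real.rpow_add hX, ← Real.rpow_add hX]
    ring_nf
  have hsq (x : UnitAddCircle) : ‖squarePoly A s k x‖ ^ (4 : ℝ) =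
      ‖∑ q ∈ S ×ˢ S, ((weight s q.1 * weight s q.2 : ℝ) : ℂ) *
        fourier ((q.1 : ℤ) ^ 2 + (q.2 : ℤ) ^ 2) x‖ ^ 2 := by
    have h4 : ‖squarePoly A s k x‖ ^ (4 : ℝ) = ‖squarePoly A s k x * squarePoly A s k x‖ ^ 2 := by
      rw [norm_mul, show (4 : ℝ) = ((4 : ℕ) : ℝ) by norm_num, Real.rpow_natCast]
      ring
    rw [h4, squarePoly, Finset.sum_mul_sum, Finset.sum_product]
    congr 2
    refine Finset.sum_congr rfl fun i _ => Finset.sum_congr rfl fun j _ => ?_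
    rw [fourier_add]
    push_cast
    ring
  unfold moment
  simp only [hsq]
  refine (integral_sq_norm_sum_fourier (S ×ˢ S) (fun q => weight s q.1 * weight s q.2)
    fun q => (q.1 : ℤ) ^ 2 + (q.2 : ℤ) ^ 2).trans_le ?_
  rw [hw4, ← Finset.sum_product', ← Finset.sum_filter, mul_comm, ← nsmul_eq_mul]
  have hsub : ((S ×ˢ S) ×ˢ (S ×ˢ S)).filter (fun q =>
      (q.1.1 : ℤ) ^ 2 + (q.1.2 : ℤ) ^ 2 = (q.2.1 : ℤ) ^ 2 + (q.2.2 : ℤ) ^ 2) ⊆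
      energySet (Nat.sqrt (A ^ (k + 1))) := by
    rintro ⟨⟨a, b⟩, ⟨c, d⟩⟩ hq
    have hm {m : ℕ} (h : m ∈ S) : 1 ≤ m ∧ m ≤ Nat.sqrt (A ^ (k + 1)) :=
      Finset.mem_Icc.1 (Finset.mem_filter.1 h).1
    simp only [Finset.mem_filter, Finset.mem_product] at hq
    obtain ⟨⟨⟨ha, hb⟩, hc, hd⟩, h⟩ := hq
    exact mem_energySet.2 ⟨⟨hm ha, hm hb⟩, ⟨hm hc, hm hd⟩, by exact_mod_cast h⟩
  refine (Finset.sum_le_card_nsmul _ _ ((w * w) * (w * w)) ?_).trans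
    (nsmul_le_nsmul_left (by positivity) (Finset.card_le_card hsub))
  rintro ⟨⟨a, b⟩, ⟨c, d⟩⟩ hq
  simp only [Finset.mem_filter, Finset.mem_product] at hq
  obtain ⟨⟨⟨ha, hb⟩, hc, hd⟩, -⟩ := hq
  have h1 := weight_le hA hs ha
  have h2 := weight_le hA hs hb
  have h3 := weight_le hA hs hc
  have h4 := weight_le hA hs hd
  have n1 := weight_nonneg s a
  have n2 := weight_nonneg s b
  have n3 := weight_nonneg s c
  have n4 := weight_nonneg s d
  have hw0 : 0 ≤ w := by positivity
  simp only
  gcongr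

lemma exists_moment_four_le {A : ℕ} (hA : 2 ≤ A) {s ε : ℝ} (hs : 0 ≤ s) (hε : 0 < ε) :
    ∃ C : ℝ, 0 < C ∧ ∀ k, moment A s k 4 ≤ C * ((A : ℝ) ^ k) ^ (1 - 4 * s + ε) := by
  obtain ⟨C, hC, h⟩ := exists_card_energySet_le hε
  refine ⟨C * (A : ℝ) ^ (1 + ε), by positivity, fun k => ?_⟩
  have hX : (0 : ℝ) < (A : ℝ) ^ k := by positivity
  have hM : 1 ≤ Nat.sqrt (A ^ (k + 1)) := Nat.le_sqrt.2 (Nat.one_le_pow _ _ (by omega))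
  have h1 : (Nat.sqrt (A ^ (k + 1)) : ℝ) ^ (2 + 2 * ε) ≤
      (A : ℝ) ^ (1 + ε) * ((A : ℝ) ^ k) ^ (1 + ε) := by
    rw [← Real.mul_rpow (by positivity) hX.le]
    calc (Nat.sqrt (A ^ (k + 1)) : ℝ) ^ (2 + 2 * ε)
        ≤ (((A : ℝ) * (A : ℝ) ^ k) ^ (1 / 2 : ℝ)) ^ (2 + 2 * ε) := by
          gcongr
          exact sqrt_scale_le A k
      _ = _ := by
          rw [← Real.rpow_mul (by positivity)]
          ring_nf
  calc moment A s k 4 ≤ ((A : ℝ) ^ k) ^ (-(4 * s)) *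
        (energySet (Nat.sqrt (A ^ (k + 1)))).card := moment_four_le hA hs
    _ ≤ ((A : ℝ) ^ k) ^ (-(4 * s)) * (C * ((A : ℝ) ^ (1 + ε) * ((A : ℝ) ^ k) ^ (1 + ε))) := by
        gcongr
        exact (h _ hM).trans (by gcongr)
    _ = C * (A : ℝ) ^ (1 + ε) * (((A : ℝ) ^ k) ^ (-(4 * s)) * ((A : ℝ) ^ k) ^ (1 + ε)) := by ring
    _ = _ := by
        rw [← Real.rpow_add hX]
        ring_nf

end RiemannBesov

/-! ### Upper bounds for all moments. -/

namespace RiemannBesov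

open MeasureTheory Filter Topology

/-- The torus has mass one and `0 ^ 0 = 1`, so constants in pointwise bounds can be treated as
multiples of the zeroth moment. -/
lemma moment_zero (A : ℕ) (s : ℝ) (k : ℕ) : moment A s k 0 = 1 := by
  simp [moment]

lemma moment_le_of_pointwise {A k : ℕ} {s p q r a b : ℝ} (hp : 0 ≤ p) (hq : 0 ≤ q) (hr : 0 ≤ r)
    (h : ∀ x, ‖squarePoly A s k x‖ ^ p ≤
      a * ‖squarePoly A s k x‖ ^ q + b * ‖squarePoly A s k x‖ ^ r) :
    moment A s k p ≤ a * moment A s k q + b * moment A s k r := by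
  unfold moment
  have hq' := (integrable_norm_squarePoly_rpow A s k hq).const_mul a
  have hr' := (integrable_norm_squarePoly_rpow A s k hr).const_mul b
  rw [← integral_const_mul, ← integral_const_mul, ← integral_add hq' hr']
  exact integral_mono (integrable_norm_squarePoly_rpow A s k hp) (hq'.add hr') h

lemma rpow_le_of_exponent_le {t l p q : ℝ} (hl : 0 < l) (ht : l ≤ t) (hpq : p ≤ q) :
    t ^ p ≤ l ^ (p - q) * t ^ q := by
  have ht0 : 0 < t := hl.trans_le ht
  calc t ^ p = t ^ (p - q) * t ^ q := by rw [← Real.rpow_add ht0, sub_add_cancel]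
    _ ≤ _ := by
      gcongr ?_ * _
      exact Real.rpow_le_rpow_of_nonpos hl ht (by linarith)

lemma rpow_le_of_exponent_ge {t l p q : ℝ} (ht0 : 0 ≤ t) (ht : t ≤ l) (hq : 0 < q)
    (hpq : q ≤ p) : t ^ p ≤ l ^ (p - q) * t ^ q := by
  calc t ^ p = t ^ (p - q) * t ^ q := by
        rw [← Real.rpow_add_of_nonneg ht0 (by linarith) hq.le, sub_add_cancel]
    _ ≤ _ := by
      gcongr ?_ * _
      exact Real.rpow_le_rpow ht0 ht (by linarith)

/-- The exponent of `A ^ k` in the size of the `p`-th moment. -/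
noncomputable def momentExponent (s p : ℝ) : ℝ :=
  if p ≤ 4 then p / 4 - p * s else p / 2 - p * s - 1

lemma norm_squarePoly_le {A k : ℕ} {s : ℝ} (hA : 2 ≤ A) (hs : 0 ≤ s) (x : UnitAddCircle) :
    ‖squarePoly A s k x‖ ≤ (A : ℝ) ^ (1 / 2 : ℝ) * ((A : ℝ) ^ k) ^ (1 / 2 - s) := by
  have hX : (0 : ℝ) < (A : ℝ) ^ k := by positivity
  calc ‖squarePoly A s k x‖ ≤ ∑ m ∈ roots A k, ((A : ℝ) ^ k) ^ (-s) := by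
        refine norm_sum_le_of_le _ fun m hm => ?_
        rw [norm_mul, norm_fourier_apply, mul_one, Complex.norm_real,
          Real.norm_of_nonneg (weight_nonneg _ _)]
        exact weight_le hA hs hm
    _ = (roots A k).card * ((A : ℝ) ^ k) ^ (-s) := by rw [Finset.sum_const, nsmul_eq_mul]
    _ ≤ ((A : ℝ) * (A : ℝ) ^ k) ^ (1 / 2 : ℝ) * ((A : ℝ) ^ k) ^ (-s) := by
        gcongr
        exact card_roots_le A k
    _ = _ := by
        rw [Real.mul_rpow (by positivity) hX.le, mul_assoc, ← Real.rpow_add hX, sub_eq_add_neg]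

lemma exists_moment_le {A : ℕ} (hA : 2 ≤ A) {s p ε : ℝ} (hs : 0 ≤ s) (hp : 0 < p) (hε : 0 < ε) :
    ∃ C : ℝ, ∀ k, moment A s k p ≤ C * ((A : ℝ) ^ k) ^ (momentExponent s p + ε) := by
  obtain ⟨C, hC, h4⟩ := exists_moment_four_le hA hs hε
  have hX (k : ℕ) : (0 : ℝ) < (A : ℝ) ^ k := by positivity
  unfold momentExponent
  split_ifs with hp4
  · refine ⟨1 + C, fun k => ?_⟩
    set X := (A : ℝ) ^ k with hXdef
    have hX0 : 0 < X := hX k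
    have hX1 : 1 ≤ X := one_le_scale hA k
    -- At the typical size `l`: below it use `t ^ p ≤ l ^ p`, above it `t ^ p ≤ l ^ (p - 4) * t ^
    -- 4`. Up to `X ^ ε` both parts contribute the same power of `X`.
    set l := X ^ (1 / 4 - s) with hl
    have hl0 : 0 < l := by positivity
    have h1 : moment A s k p ≤ l ^ p * moment A s k 0 + l ^ (p - 4) * moment A s k 4 := by
      refine moment_le_of_pointwise hp.le le_rfl (by norm_num) fun x => ?_
      rw [Real.rpow_zero, mul_one]
      have h0 := norm_nonneg (squarePoly A s k x)
      rcases le_total ‖squarePoly A s k x‖ l with ht | ht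
      · exact (Real.rpow_le_rpow h0 ht hp.le).trans (le_add_of_nonneg_right (by positivity))
      · exact (rpow_le_of_exponent_le hl0 ht hp4).trans (le_add_of_nonneg_left (by positivity))
    have h2 : l ^ p ≤ X ^ (p / 4 - p * s + ε) := by
      rw [hl, ← Real.rpow_mul hX0.le]
      exact Real.rpow_le_rpow_of_exponent_le hX1 (by linarith)
    have h3 : l ^ (p - 4) * moment A s k 4 ≤ C * X ^ (p / 4 - p * s + ε) := by
      calc l ^ (p - 4) * moment A s k 4 ≤ l ^ (p - 4) * (C * X ^ (1 - 4 * s + ε)) := by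
            gcongr
            exact h4 k
        _ = C * (X ^ ((1 / 4 - s) * (p - 4)) * X ^ (1 - 4 * s + ε)) := by
            rw [hl, ← Real.rpow_mul hX0.le]
            ring
        _ = _ := by
            rw [← Real.rpow_add hX0]
            ring_nf
    rw [moment_zero, mul_one] at h1
    linarith
  · push Not at hp4
    refine ⟨((A : ℝ) ^ (1 / 2 : ℝ)) ^ (p - 4) * C, fun k => ?_⟩
    set X := (A : ℝ) ^ k with hXdef
    have hX0 : 0 < X := hX k
    have h1 : moment A s k p ≤ ((A : ℝ) ^ (1 / 2 : ℝ) * X ^ (1 / 2 - s)) ^ (p - 4) *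
        moment A s k 4 + 0 * moment A s k 0 := by
      refine moment_le_of_pointwise hp.le (by norm_num) le_rfl fun x => ?_
      rw [zero_mul, add_zero]
      exact rpow_le_of_exponent_ge (norm_nonneg _) (norm_squarePoly_le hA hs x) (by norm_num)
        hp4.le
    rw [zero_mul, add_zero] at h1
    calc moment A s k p ≤ ((A : ℝ) ^ (1 / 2 : ℝ) * X ^ (1 / 2 - s)) ^ (p - 4) *
          (C * X ^ (1 - 4 * s + ε)) := h1.trans (by gcongr; exact h4 k)
      _ = ((A : ℝ) ^ (1 / 2 : ℝ)) ^ (p - 4) * C *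
          (X ^ ((1 / 2 - s) * (p - 4)) * X ^ (1 - 4 * s + ε)) := by
          rw [Real.mul_rpow (by positivity) (by positivity), ← Real.rpow_mul hX0.le]
          ring
      _ = _ := by
          rw [← Real.rpow_add hX0]
          ring_nf

/-! ### The peak at zero and lower bounds for all moments. -/

lemma re_fourier_coe (n : ℤ) (y : ℝ) :
    (fourier n (y : UnitAddCircle)).re = Real.cos (2 * Real.pi * n * y) := by
  rw [fourier_coe_apply]
  have : (2 * Real.pi * Complex.I * n * y / ((1 : ℝ) : ℂ) : ℂ) =
      ((2 * Real.pi * n * y : ℝ) : ℂ) * Complex.I := by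
    push_cast
    ring
  rw [this, Complex.exp_ofReal_mul_I_re]

/-- All phases `2π m² y` lie in `[0, 1]`, where the cosine is at least `1/2`, so the real parts add
up without cancellation. -/
lemma le_norm_squarePoly_coe {A k : ℕ} {s y : ℝ} (hs : 0 ≤ s) (hy : 0 ≤ y)
    (hy' : 2 * Real.pi * ((A : ℝ) * (A : ℝ) ^ k) * y ≤ 1) :
    (roots A k).card * (((A : ℝ) * (A : ℝ) ^ k) ^ (-s) / 2) ≤
      ‖squarePoly A s k (y : UnitAddCircle)‖ := by
  refine le_trans ?_ (Complex.re_le_norm _)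
  rw [squarePoly, Complex.re_sum, ← nsmul_eq_mul]
  refine Finset.card_nsmul_le_sum _ _ _ fun m hm => ?_
  rw [Complex.re_ofReal_mul, re_fourier_coe, div_eq_mul_inv]
  have hm2 : ((m : ℝ) ^ 2) ≤ (A : ℝ) * (A : ℝ) ^ k := by
    rw [← pow_succ']
    exact_mod_cast (mem_roots.1 hm).2.2.le
  have h0 : 0 ≤ 2 * Real.pi * (((m : ℤ) ^ 2 : ℤ) : ℝ) * y := by positivity
  have h1 : 2 * Real.pi * (((m : ℤ) ^ 2 : ℤ) : ℝ) * y ≤ 1 := by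
    refine le_trans ?_ hy'
    push_cast
    gcongr
  have h2 : (2 : ℝ)⁻¹ ≤ Real.cos (2 * Real.pi * (((m : ℤ) ^ 2 : ℤ) : ℝ) * y) := by
    have := Real.one_sub_sq_div_two_le_cos (x := 2 * Real.pi * (((m : ℤ) ^ 2 : ℤ) : ℝ) * y)
    nlinarith
  exact mul_le_mul (le_weight hs hm) h2 (by norm_num) (weight_nonneg _ _)

lemma mul_rpow_le_moment {A k : ℕ} {s p d B : ℝ} (hp : 0 < p) (hd : 0 ≤ d) (hd1 : d ≤ 1)
    (hB : 0 ≤ B) (h : ∀ y ∈ Set.Icc 0 d, B ≤ ‖squarePoly A s k (y : UnitAddCircle)‖) :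
    d * B ^ p ≤ moment A s k p := by
  have hcont : Continuous fun y : ℝ => ‖squarePoly A s k (y : UnitAddCircle)‖ ^ p :=
    (((continuous_squarePoly A s k).comp (AddCircle.continuous_mk' 1)).norm).rpow_const
      fun _ => Or.inr hp.le
  have hm : moment A s k p = ∫ y in (0 : ℝ)..1, ‖squarePoly A s k (y : UnitAddCircle)‖ ^ p := by
    have h1 := UnitAddCircle.intervalIntegral_preimage 0
      fun x : UnitAddCircle => ‖squarePoly A s k x‖ ^ p
    rw [zero_add] at h1
    rw [h1, AddCircle.volume_eq_smul_haarAddCircle, ENNReal.ofReal_one, one_smul]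
    rfl
  rw [hm]
  calc d * B ^ p = ∫ _ in (0 : ℝ)..d, B ^ p := by
        rw [intervalIntegral.integral_const, sub_zero, smul_eq_mul]
    _ ≤ ∫ y in (0 : ℝ)..d, ‖squarePoly A s k (y : UnitAddCircle)‖ ^ p := by
        refine intervalIntegral.integral_mono_on hd (by simp) (hcont.intervalIntegrable _ _)
          fun y hy => ?_
        exact Real.rpow_le_rpow hB (h y hy) hp.le
    _ ≤ _ := by
        refine intervalIntegral.integral_mono_interval le_rfl hd hd1
          (Eventually.of_forall fun y => by positivity) (hcont.intervalIntegrable _ _)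

lemma exists_le_moment_of_peak {A : ℕ} (hA : 2 ≤ A) {s p : ℝ} (hs : 0 ≤ s) (hp : 0 < p) :
    ∃ c : ℝ, 0 < c ∧ ∀ᶠ k in atTop,
      c * ((A : ℝ) ^ k) ^ (p / 2 - p * s - 1) ≤ moment A s k p := by
  have hA0 : (0 : ℝ) < A := by positivity
  have hpi := Real.pi_pos
  -- The arc has length `(2πAX)⁻¹`; `12` combines the `6` from counting the roots with the `2` from
  -- the cosine.
  refine ⟨(2 * Real.pi * A)⁻¹ * ((A : ℝ) ^ (-s) / 12) ^ p, by positivity, ?_⟩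
  filter_upwards [eventually_le_card_roots hA] with k hk
  set X := (A : ℝ) ^ k with hXdef
  have hX0 : 0 < X := by positivity
  have hX1 : 1 ≤ X := one_le_scale hA k
  have hd : 1 ≤ 2 * Real.pi * (A * X) := by
    have h1 : (2 : ℝ) ≤ A := by exact_mod_cast hA
    have h2 := Real.pi_gt_three
    have h3 : 2 ≤ A * X := by nlinarith
    nlinarith
  have h := mul_rpow_le_moment (A := A) (k := k) (s := s) (d := (2 * Real.pi * (A * X))⁻¹)
    (B := (A : ℝ) ^ (-s) / 12 * X ^ (1 / 2 - s)) hp (by positivity) (inv_le_one_of_one_le₀ hd)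
    (by positivity) fun y hy => ?_
  · refine le_trans (le_of_eq ?_) h
    rw [Real.mul_rpow (by positivity) (by positivity), ← Real.rpow_mul hX0.le, mul_inv, mul_inv,
      mul_inv, Real.rpow_sub_one hX0.ne']
    rw [show (1 / 2 - s) * p = p / 2 - p * s by ring]
    field_simp
  · refine le_trans ?_ (le_norm_squarePoly_coe hs hy.1 ?_)
    · rw [← hXdef, Real.mul_rpow hA0.le hX0.le, sub_eq_add_neg, Real.rpow_add hX0]
      calc (A : ℝ) ^ (-s) / 12 * (X ^ (1 / 2 : ℝ) * X ^ (-s))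
          = X ^ (1 / 2 : ℝ) / 6 * ((A : ℝ) ^ (-s) * X ^ (-s) / 2) := by ring
        _ ≤ _ := by gcongr
    · calc 2 * Real.pi * (A * X) * y ≤ 2 * Real.pi * (A * X) * (2 * Real.pi * (A * X))⁻¹ := by
            gcongr
            exact hy.2
        _ = 1 := mul_inv_cancel₀ (by positivity)

/-- A bound `X ^ y ≲ X ^ a * I + (negligible)` gives `X ^ (y - a) ≲ I`. -/
lemma le_of_le_mul_add {X c y a I Z : ℝ} (hX : 0 < X) (h : c * X ^ y ≤ X ^ a * I + Z)
    (hZ : Z ≤ c / 2 * X ^ y) : c / 2 * X ^ (y - a) ≤ I := by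
  rw [Real.rpow_sub hX, ← mul_div_assoc, div_le_iff₀ (by positivity)]
  linarith

lemma eventually_scale_rpow_neg_le {A : ℕ} (hA : 2 ≤ A) {d c : ℝ} (hd : 0 < d) (hc : 0 < c) :
    ∀ᶠ k in atTop, ((A : ℝ) ^ k) ^ (-d) ≤ c :=
  ((tendsto_rpow_neg_atTop hd).comp (tendsto_scale hA)).eventually_le_const hc

lemma exists_le_moment {A : ℕ} (hA : 2 ≤ A) {s p ε : ℝ} (hs : 0 ≤ s) (hp : 0 < p) (hε : 0 < ε) :
    ∃ c : ℝ, 0 < c ∧ ∀ᶠ k in atTop,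
      c * ((A : ℝ) ^ k) ^ (momentExponent s p - ε) ≤ moment A s k p := by
  unfold momentExponent
  split_ifs with hp4
  · obtain ⟨c, hc, h2⟩ := exists_le_moment_two hA hs
    obtain ⟨C, hC, h4⟩ := exists_moment_four_le hA hs (half_pos hε)
    have hsmall := eventually_scale_rpow_neg_le hA (half_pos hε)
      (show 0 < min (c / 2) (c / (2 * C)) by positivity)
    refine ⟨c / 2, by positivity, ?_⟩
    filter_upwards [h2, hsmall] with k h2 hsmall
    set X := (A : ℝ) ^ k with hXdef
    have hX0 : 0 < X := by positivity
    have hX1 : 1 ≤ X := one_le_scale hA k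
    have hpow (μ r : ℝ) : (X ^ μ) ^ r = X ^ (μ * r) := (Real.rpow_mul hX0.le _ _).symm
    -- The cutting level is `X ^ μ`. It bounds the second moment by `X ^ (μ (2 - p))` times the
    -- `p`-th moment plus an error, and `μ` is moved slightly off `1/4 - s` so that the error can be
    -- absorbed.
    suffices H : ∃ μ : ℝ, p / 4 - p * s - ε ≤ 1 / 2 - 2 * s - μ * (2 - p) ∧
        c / 2 * X ^ (1 / 2 - 2 * s - μ * (2 - p)) ≤ moment A s k p by
      obtain ⟨μ, hμ, h⟩ := H
      refine le_trans ?_ h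
      gcongr
    rcases le_total p 2 with hp2 | hp2
    -- For `p ≤ 2` the error is the contribution of large values, controlled by the fourth moment.
    -- Raising the level by `X ^ (ε / 2)` gains `X ^ (-ε)`, which beats the loss `X ^ (ε / 2)` in
    -- that moment.
    · refine ⟨1 / 4 - s + ε / 2, by nlinarith, ?_⟩
      set l := X ^ (1 / 4 - s + ε / 2) with hl
      have hl0 : 0 < l := by positivity
      have h1 : moment A s k 2 ≤ l ^ (2 - p) * moment A s k p +
          l ^ (2 - 4 : ℝ) * moment A s k 4 := by
        refine moment_le_of_pointwise (by norm_num) hp.le (by norm_num) fun x => ?_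
        rcases le_total ‖squarePoly A s k x‖ l with ht | ht
        · exact (rpow_le_of_exponent_ge (norm_nonneg _) ht hp hp2).trans
            (le_add_of_nonneg_right (by positivity))
        · exact (rpow_le_of_exponent_le hl0 ht (by norm_num)).trans
            (le_add_of_nonneg_left (by positivity))
      have h3 : l ^ (2 - 4 : ℝ) * moment A s k 4 ≤ c / 2 * X ^ (1 / 2 - 2 * s) := by
        calc l ^ (2 - 4 : ℝ) * moment A s k 4
            ≤ l ^ (2 - 4 : ℝ) * (C * X ^ (1 - 4 * s + ε / 2)) := by
              gcongr
              exact h4 k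
          _ = C * (X ^ (-(ε / 2)) * X ^ (1 / 2 - 2 * s)) := by
              rw [hl, hpow, mul_left_comm, ← Real.rpow_add hX0, ← Real.rpow_add hX0]
              ring_nf
          _ ≤ C * (c / (2 * C) * X ^ (1 / 2 - 2 * s)) := by
              gcongr
              exact hsmall.trans (min_le_right _ _)
          _ = _ := by field_simp
      rw [hl, hpow] at h1
      exact le_of_le_mul_add hX0 (h2.trans h1) h3
    -- For `2 ≤ p ≤ 4` the error comes from small values and is at most `l ^ 2`, so the level is
    -- lowered instead.
    · refine ⟨1 / 4 - s - ε / 4, by nlinarith, ?_⟩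
      set l := X ^ (1 / 4 - s - ε / 4) with hl
      have hl0 : 0 < l := by positivity
      have h1 : moment A s k 2 ≤ l ^ (2 - p) * moment A s k p +
          l ^ (2 : ℝ) * moment A s k 0 := by
        refine moment_le_of_pointwise (by norm_num) hp.le le_rfl fun x => ?_
        rw [Real.rpow_zero, mul_one]
        rcases le_total ‖squarePoly A s k x‖ l with ht | ht
        · exact (Real.rpow_le_rpow (norm_nonneg _) ht (by norm_num)).trans
            (le_add_of_nonneg_left (by positivity))
        · exact (rpow_le_of_exponent_le hl0 ht hp2).trans
            (le_add_of_nonneg_right (by positivity))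
      have h3 : l ^ (2 : ℝ) * moment A s k 0 ≤ c / 2 * X ^ (1 / 2 - 2 * s) := by
        calc l ^ (2 : ℝ) * moment A s k 0 = X ^ (-(ε / 2)) * X ^ (1 / 2 - 2 * s) := by
              rw [moment_zero, mul_one, hl, hpow, ← Real.rpow_add hX0]
              ring_nf
          _ ≤ _ := by
              gcongr
              exact hsmall.trans (min_le_left _ _)
      rw [hl, hpow] at h1
      exact le_of_le_mul_add hX0 (h2.trans h1) h3
  · obtain ⟨c, hc, h⟩ := exists_le_moment_of_peak hA hs hp
    refine ⟨c, hc, ?_⟩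
    filter_upwards [h] with k hk
    refine le_trans ?_ hk
    have hX1 : (1 : ℝ) ≤ (A : ℝ) ^ k := one_le_scale hA k
    exact mul_le_mul_of_nonneg_left (Real.rpow_le_rpow_of_exponent_le hX1 (by linarith)) hc.le

/-! ### The critical exponent. -/

lemma memBesov_of_lt {A : ℕ} (hA : 2 ≤ A) {s σ p : ℝ} (hs : 1 / 2 < s) (hp : 0 < p)
    (hσ : σ < -momentExponent s p) : MemBesov A (σ / p) p (R s) := by
  obtain ⟨C, hC⟩ := exists_moment_le hA (s := s) (p := p) (ε := -momentExponent s p - σ)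
    (by linarith) hp (by linarith)
  refine (memBesov_R_iff hA hs hp).2 ⟨C, fun k => ?_⟩
  have hX : (0 : ℝ) < (A : ℝ) ^ k := by positivity
  calc ((A : ℝ) ^ k) ^ σ * moment A s k p
      ≤ ((A : ℝ) ^ k) ^ σ *
        (C * ((A : ℝ) ^ k) ^ (momentExponent s p + (-momentExponent s p - σ))) := by
        gcongr
        exact hC k
    _ = C * (((A : ℝ) ^ k) ^ σ *
        ((A : ℝ) ^ k) ^ (momentExponent s p + (-momentExponent s p - σ))) := by ring
    _ = C := by
        rw [← Real.rpow_add hX]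
        ring_nf
        simp

lemma le_of_memBesov {A : ℕ} (hA : 2 ≤ A) {s σ p : ℝ} (hs : 1 / 2 < s) (hp : 0 < p)
    (h : MemBesov A (σ / p) p (R s)) : σ ≤ -momentExponent s p := by
  by_contra! hσ
  obtain ⟨C, hC⟩ := (memBesov_R_iff hA hs hp).1 h
  -- Half of the gap is spent on the loss in the lower bound; the other half leaves an unbounded
  -- factor `X ^ ε`.
  set ε := (σ + momentExponent s p) / 2 with hε
  have hε0 : 0 < ε := by linarith
  obtain ⟨c, hc, hlow⟩ := exists_le_moment hA (by linarith : (0 : ℝ) ≤ s) hp hε0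
  have hinf : ∀ᶠ k : ℕ in atTop, C / c + 1 ≤ ((A : ℝ) ^ k) ^ ε :=
    ((tendsto_rpow_atTop hε0).comp (tendsto_scale hA)).eventually_ge_atTop _
  obtain ⟨k, hk, hk'⟩ := (hlow.and hinf).exists
  have hX : (0 : ℝ) < (A : ℝ) ^ k := by positivity
  have h1 : c * ((A : ℝ) ^ k) ^ ε ≤ C := by
    calc c * ((A : ℝ) ^ k) ^ ε
        = ((A : ℝ) ^ k) ^ σ * (c * ((A : ℝ) ^ k) ^ (momentExponent s p - ε)) := by
          rw [mul_left_comm, ← Real.rpow_add hX]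
          congr 2
          rw [hε]
          ring
      _ ≤ ((A : ℝ) ^ k) ^ σ * moment A s k p := by gcongr
      _ ≤ C := hC k
  have h2 : c * (C / c + 1) ≤ C := (mul_le_mul_of_nonneg_left hk' hc.le).trans h1
  rw [mul_add, mul_div_cancel₀ _ hc.ne'] at h2
  linarith

lemma eta_eq {A : ℕ} (hA : 2 ≤ A) {s p : ℝ} (hs : 1 / 2 < s) (hp : 0 < p) :
    eta A s p = ((-momentExponent s p : ℝ) : EReal) := by
  unfold eta
  refine le_antisymm (sSup_le ?_) ?_
  · rintro _ ⟨σ, h, rfl⟩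
    exact EReal.coe_le_coe_iff.2 (le_of_memBesov hA hs hp h)
  · refine EReal.ge_of_forall_gt_iff_ge.1 fun σ hσ => ?_
    have hσ' : σ < -momentExponent s p := EReal.coe_lt_coe_iff.1 hσ
    exact le_sSup ⟨σ, memBesov_of_lt hA hs hp hσ', rfl⟩

end RiemannBesov

theorem propositionE (A : ℕ) (hA : 2 ≤ A) (s p : ℝ) (hs : 1 / 2 < s) (hp : 0 < p) :
    RiemannBesov.eta A s p =
      ((if p ≤ 4 then p * (s - 1 / 4) else 1 + p * (s - 1 / 2) : ℝ) : EReal) := by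
  rw [RiemannBesov.eta_eq hA hs hp, RiemannBesov.momentExponent]
  congr 1
  split_ifs <;> ring
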